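/- Let $K\ge 1$ be the number of users, $H_k\in\mathbb C^{N_k\times M}$ ($1\le k\le K$) channel matrices, $d$ the number of streams and $P$ the power budget. For $W\in\mathbb C^{M\times d}$ put $R_k(W)=\log|I+H_kWW^\dagger H_k^\dagger|$, and consider $$(\mathrm{P1})\qquad \max_{\|W\|_F^2\le P}\ \min_{1\le k\le K} R_k(W).$$ For $G_k\in\mathbb C^{N_k\times d}$ and $S_k\in\mathbb C^{d\times d}$, $S_k\succ 0$, let $E_k(G_k,W)=(G_k^\dagger H_kW-I)(G_k^\dagger H_kW-I)^\dagger+G_k^\dagger G_k$ and $$g(W,\{G_k,S_k\})=\min_{1\le k\le K}\bigl(-\mathrm{Tr}[S_kE_k(G_k,W)]+\log|S_k|+d\bigr).$$ Consider the following cyclic alternating ascent algorithm, run without a limit on the number of iterations. It starts from any $W(0)$ with $\|W(0)\|_F^2\le P$. For $i=0,1,2,\dots$ it sets, for all $k$, $$G_k(i)=\bigl(H_kW(i)W(i)^\dagger H_k^\dagger+I\bigr)^{-1}H_kW(i),\qquad S_k(i)=W(i)^\dagger H_k^\dagger H_kW(i)+I,$$ factorizes $S_k(i)=B_kB_k^\dagger$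 (for example by Cholesky), and takes as $W(i+1)$ the $W$-part of any optimal solution of the second-order cone program $$\max_{W,\beta}\ \beta\quad\text{s.t.}\quad \|W\|_F^2\le P,\quad c_k-\beta\ge\bigl\|B_k^\dagger\bigl(G_k(i)^\dagger H_kW-I\bigr)\bigr\|_F^2\ \ \forall k,\qquad c_k=\log|S_k(i)|+d-\|G_k(i)B_k\|_F^2 .$$ Call $W$ a stationary point of (P1) if $\|W\|_F^2\le P$ and there are multipliers $\lambda_k\ge0$ with $\sum_k\lambda_k=1$ and $\nu\ge0$ such that $\sum_k\lambda_k\nabla R_k(W)=\nu\nabla\|W\|_F^2$, $\lambda_k\bigl(R_k(W)-\min_jR_j(W)\bigr)=0$ for all $k$, and $\nu(\|W\|_F^2-P)=0$ (the KKT conditions; gradients are with respect to the real and imaginary parts of $W$). Then for every sequence generated by the algorithm: (i) the objective is non-decreasing as the iterations proceed: $g(W(i),\{G_k(i),S_k(i)\})\le g(W(i+1),\{G_k(i),S_k(i)\})\le g(W(i+1),\{G_k(i+1),S_k(i+1)\})$ and $\min_kR_k(W(i))\le\min_kR_k(W(i+1))$ for all $i$; (ii) if the sequence $W(i)$ converges,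 its limit is a stationary point of (P1); and, whether or not it converges, it has at least one accumulation point and each of its accumulation points is a stationary point of (P1). -/

import Mathlib

open Filter Topology
open scoped Matrix BigOperators

namespace Multicast

noncomputable section

/-- The squared Frobenius norm of a complex matrix. -/
def frobSq {m n : ℕ} (A : Matrix (Fin m) (Fin n) ℂ) : ℝ :=
  ∑ i, ∑ j, ‖A i j‖ ^ 2

/-- `log |A|` for a matrix `A` whose determinant is a positive real number. -/
def logDet {n : ℕ} (A : Matrix (Fin n) (Fin n) ℂ) : ℝ :=
  Real.log (A.det).re

/-- The rate `R_k(W) = log |I + H_k W W† H_k†|` of the user with channel matrix `Hk`. -/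
def rate {N M d : ℕ} (Hk : Matrix (Fin N) (Fin M) ℂ) (W : Matrix (Fin M) (Fin d) ℂ) : ℝ :=
  logDet (1 + Hk * W * Wᴴ * Hkᴴ)

/-- The objective `min_k R_k(W)` of the max-min rate problem. -/
def minRate {K M d : ℕ} {N : Fin K → ℕ} (H : ∀ k, Matrix (Fin (N k)) (Fin M) ℂ)
    (W : Matrix (Fin M) (Fin d) ℂ) : ℝ :=
  ⨅ k, rate (H k) W

/-- The continuous codebook `{W | ‖W‖_F² ≤ P}`. -/
def codebook (M d : ℕ) (P : ℝ) : Set (Matrix (Fin M) (Fin d) ℂ) :=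
  {W | frobSq W ≤ P}

/-- The MSE matrix `E_k(G, W) = (G† H_k W - I)(G† H_k W - I)† + G† G`. -/
def mse {N M d : ℕ} (Hk : Matrix (Fin N) (Fin M) ℂ) (G : Matrix (Fin N) (Fin d) ℂ)
    (W : Matrix (Fin M) (Fin d) ℂ) : Matrix (Fin d) (Fin d) ℂ :=
  (Gᴴ * Hk * W - 1) * (Gᴴ * Hk * W - 1)ᴴ + Gᴴ * G

/-- `r_k(W, G, S) = -Tr(S E_k(G, W)) + log |S| + d`. -/
def userObj {N M d : ℕ} (Hk : Matrix (Fin N) (Fin M) ℂ) (W : Matrix (Fin M) (Fin d) ℂ)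
    (G : Matrix (Fin N) (Fin d) ℂ) (S : Matrix (Fin d) (Fin d) ℂ) : ℝ :=
  -(S * mse Hk G W).trace.re + logDet S + d

/-- The reformulated objective `g(W, {G_k, S_k}) = min_k r_k(W, G_k, S_k)`. -/
def obj {K M d : ℕ} {N : Fin K → ℕ} (H : ∀ k, Matrix (Fin (N k)) (Fin M) ℂ)
    (W : Matrix (Fin M) (Fin d) ℂ) (G : ∀ k, Matrix (Fin (N k)) (Fin d) ℂ)
    (S : Fin K → Matrix (Fin d) (Fin d) ℂ) : ℝ :=
  ⨅ k, userObj (H k) W (G k) (S k)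

/-- The LMMSE receive filter `(H_k W W† H_k† + I)⁻¹ H_k W`. -/
def lmmse {N M d : ℕ} (Hk : Matrix (Fin N) (Fin M) ℂ) (W : Matrix (Fin M) (Fin d) ℂ) :
    Matrix (Fin N) (Fin d) ℂ :=
  (Hk * W * Wᴴ * Hkᴴ + 1)⁻¹ * (Hk * W)

/-- The slack matrix update `W† H_k† H_k W + I`. -/
def slack {N M d : ℕ} (Hk : Matrix (Fin N) (Fin M) ℂ) (W : Matrix (Fin M) (Fin d) ℂ) :
    Matrix (Fin d) (Fin d) ℂ :=
  Wᴴ * Hkᴴ * Hk * W + 1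

/-- Feasibility of `(W, β)` for the second-order cone program of the precoder step:
`‖W‖_F² ≤ P` and `c_k - β ≥ ‖B_k† (G_k† H_k W - I)‖_F²` for all `k`, with the constant
`c_k = log |S_k| + d - ‖G_k B_k‖_F²`. -/
def SOCPFeasible {K M d : ℕ} {N : Fin K → ℕ} (H : ∀ k, Matrix (Fin (N k)) (Fin M) ℂ) (P : ℝ)
    (G : ∀ k, Matrix (Fin (N k)) (Fin d) ℂ) (S B : Fin K → Matrix (Fin d) (Fin d) ℂ)
    (W : Matrix (Fin M) (Fin d) ℂ) (β : ℝ) : Prop :=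
  W ∈ codebook M d P ∧
    ∀ k, frobSq ((B k)ᴴ * ((G k)ᴴ * H k * W - 1)) ≤
      (logDet (S k) + d - frobSq (G k * B k)) - β

/-- `W` is the precoder part of an optimal solution `(W, β)` of the second-order cone program
that maximizes `β`. -/
def SOCPSolution {K M d : ℕ} {N : Fin K → ℕ} (H : ∀ k, Matrix (Fin (N k)) (Fin M) ℂ) (P : ℝ)
    (G : ∀ k, Matrix (Fin (N k)) (Fin d) ℂ) (S B : Fin K → Matrix (Fin d) (Fin d) ℂ)
    (W : Matrix (Fin M) (Fin d) ℂ) : Prop :=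
  ∃ β : ℝ, SOCPFeasible H P G S B W β ∧
    ∀ (W' : Matrix (Fin M) (Fin d) ℂ) (β' : ℝ), SOCPFeasible H P G S B W' β' → β' ≤ β

/-- `(W, G, S)` is a run, without a limit on the number of iterations, of the cyclic alternating
ascent algorithm. `W 0` is the feasible input; pass `i` of the loop computes the filters `G i k` and
the slack matrices `S i k` from the current precoder `W i`, and then takes for `W (i + 1)` some
optimal solution of the second-order cone program written with a factorization `S_k = B_k B_k†`
(any one, in particular the Cholesky factorization). -/
structure IsAscentRun {K M d : ℕ} {N : Fin K → ℕ} (H : ∀ k, Matrix (Fin (N k)) (Fin M) ℂ) (P : ℝ)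
    (W : ℕ → Matrix (Fin M) (Fin d) ℂ) (G : ℕ → ∀ k, Matrix (Fin (N k)) (Fin d) ℂ)
    (S : ℕ → Fin K → Matrix (Fin d) (Fin d) ℂ) : Prop where
  init : W 0 ∈ codebook M d P
  filter_step : ∀ i k, G i k = lmmse (H k) (W i)
  slack_step : ∀ i k, S i k = slack (H k) (W i)
  precoder_step : ∀ i, ∃ B : Fin K → Matrix (Fin d) (Fin d) ℂ,
    (∀ k, S i k = B k * (B k)ᴴ) ∧ SOCPSolution H P (G i) (S i) B (W (i + 1))

/-- `W` is a stationary point of `max_{‖W‖_F² ≤ P} min_k R_k(W)`: it is feasible and satisfies the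
KKT conditions of the epigraph form `max t` subject to `R_k(W) ≥ t` for all `k` and `‖W‖_F² ≤ P`,
where necessarily `t = min_k R_k(W)`. Derivatives are those of real-valued functions on the real
vector space of complex matrices; `lam k` and `ν` are the multipliers. -/
def IsStationary {K M d : ℕ} {N : Fin K → ℕ} (H : ∀ k, Matrix (Fin (N k)) (Fin M) ℂ) (P : ℝ)
    (W : Matrix (Fin M) (Fin d) ℂ) : Prop :=
  W ∈ codebook M d P ∧
  ∃ (A : Fin K → Matrix (Fin M) (Fin d) ℂ →L[ℝ] ℝ) (D : Matrix (Fin M) (Fin d) ℂ →L[ℝ] ℝ)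
    (lam : Fin K → ℝ) (ν : ℝ),
    (∀ k, HasFDerivAt (fun V : Matrix (Fin M) (Fin d) ℂ => rate (H k) V) (A k) W) ∧
    HasFDerivAt (fun V : Matrix (Fin M) (Fin d) ℂ => frobSq V) D W ∧
    (∀ k, 0 ≤ lam k) ∧ 0 ≤ ν ∧ ∑ k, lam k = 1 ∧
    ∑ k, lam k • A k = ν • D ∧
    (∀ k, lam k * (rate (H k) W - minRate H W) = 0) ∧
    ν * (frobSq W - P) = 0

end

end Multicast

/-! The algorithm is minorize-maximize. Completing the square in `G` (`mse_lmmse_add`) and the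
tangent-plane bound for the concave `log det` (`logDet_sub_le_trace_mul_inv`) show that each user's
surrogate lies below the rate for every `G` and every positive definite `S`, with equality at the
filter and slack computed from the same precoder. The cone program maximizes the minimum of these
surrogates, which gives monotonicity. For an accumulation point, the surrogate built at `W n` is at
most `minRate H (W (n + 1))` on the whole codebook, hence at most the limiting value. By continuity
the limit maximizes the surrogate built at itself. Surrogate and rate touch there, so their
gradients agree, and no direction improves all active rates while reducing an active power
constraint. Gordan's theorem turns this into multipliers. They do not all sit on the power
constraint, since its derivative along `W` is `2 * frobSq W`, positive unless `W = 0`; there every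
rate gradient vanishes. -/

namespace Multicast

/-! ### The surrogate as a tight lower bound of the rate. -/

section MatrixIdentities

open scoped ComplexOrder

theorem frobSq_eq_trace {m n : ℕ} (A : Matrix (Fin m) (Fin n) ℂ) :
    frobSq A = (A * Aᴴ).trace.re := by
  simp only [frobSq, Matrix.trace, Matrix.diag_apply, Matrix.mul_apply, Matrix.conjTranspose_apply,
    Complex.re_sum]
  refine Finset.sum_congr rfl fun i _ => Finset.sum_congr rfl fun j _ => ?_
  rw [Complex.star_def, Complex.mul_conj, Complex.ofReal_re, Complex.normSq_eq_norm_sq]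

theorem posDef_slack {N M d : ℕ} (Hk : Matrix (Fin N) (Fin M) ℂ) (W : Matrix (Fin M) (Fin d) ℂ) :
    (slack Hk W).PosDef := by
  have h : slack Hk W = (Hk * W)ᴴ * (Hk * W) + 1 := by
    simp [slack, Matrix.conjTranspose_mul, Matrix.mul_assoc]
  rw [h]
  exact Matrix.PosDef.posSemidef_add (Matrix.posSemidef_conjTranspose_mul_self _) Matrix.PosDef.one

theorem rate_eq_logDet_slack {N M d : ℕ} (Hk : Matrix (Fin N) (Fin M) ℂ)
    (W : Matrix (Fin M) (Fin d) ℂ) : rate Hk W = logDet (slack Hk W) := by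
  unfold rate logDet slack
  rw [Matrix.mul_assoc (Hk * W), Matrix.det_one_add_mul_comm, add_comm, ← Matrix.mul_assoc]

/-- Completing the square: the error is quadratic in `G` with weight `Q = X * Xᴴ + 1`, `X = Hk * W`,
and minimizer `Q⁻¹ * X`. The remainder `1 - Xᴴ * Q⁻¹ * X` is the inverse slack, by the push-through
identity. -/
theorem mse_lmmse_add {N M d : ℕ} (Hk : Matrix (Fin N) (Fin M) ℂ) (G : Matrix (Fin N) (Fin d) ℂ)
    (W : Matrix (Fin M) (Fin d) ℂ) :
    mse Hk G W = (slack Hk W)⁻¹ +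
      (G - lmmse Hk W)ᴴ * (Hk * W * Wᴴ * Hkᴴ + 1) * (G - lmmse Hk W) := by
  obtain ⟨X, hX⟩ : ∃ X, X = Hk * W := ⟨_, rfl⟩
  have hQ : Hk * W * Wᴴ * Hkᴴ + 1 = X * Xᴴ + 1 := by
    simp [hX, Matrix.conjTranspose_mul, Matrix.mul_assoc]
  have hT : slack Hk W = Xᴴ * X + 1 := by
    simp [slack, hX, Matrix.conjTranspose_mul, Matrix.mul_assoc]
  have hE : mse Hk G W = (Gᴴ * X - 1) * (Gᴴ * X - 1)ᴴ + Gᴴ * G := by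
    simp [mse, hX, Matrix.mul_assoc]
  have hG : lmmse Hk W = (X * Xᴴ + 1)⁻¹ * X := by
    rw [lmmse, hQ, hX]
  rw [hE, hT, hQ, hG]
  have hpos : (X * Xᴴ + 1).PosDef :=
    Matrix.PosDef.posSemidef_add (Matrix.posSemidef_self_mul_conjTranspose _) Matrix.PosDef.one
  obtain ⟨Q, hQdef⟩ : ∃ Q, Q = X * Xᴴ + 1 := ⟨_, rfl⟩
  rw [← hQdef] at hpos ⊢
  have hu : IsUnit Q.det := hpos.det_pos.ne'.isUnit
  have hQi : Q⁻¹ᴴ = Q⁻¹ := by rw [Matrix.conjTranspose_nonsing_inv, hpos.isHermitian.eq]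
  have hinv : (Xᴴ * X + 1)⁻¹ = 1 - Xᴴ * Q⁻¹ * X := by
    apply Matrix.inv_eq_right_inv
    have h1 : (Xᴴ * X + 1) * (Xᴴ * Q⁻¹ * X) = Xᴴ * X := by
      have : (Xᴴ * X + 1) * (Xᴴ * Q⁻¹ * X) = Xᴴ * (Q * Q⁻¹) * X := by
        rw [hQdef]
        simp only [Matrix.add_mul, Matrix.mul_add, Matrix.mul_assoc, Matrix.one_mul]
      rw [this, Matrix.mul_nonsing_inv _ hu, Matrix.mul_one]
    rw [Matrix.mul_sub, h1, Matrix.mul_one, add_sub_cancel_left]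
  have h2 : (G - Q⁻¹ * X)ᴴ * Q * (G - Q⁻¹ * X)
      = Gᴴ * Q * G - Gᴴ * X - Xᴴ * G + Xᴴ * Q⁻¹ * X := by
    rw [Matrix.conjTranspose_sub, Matrix.conjTranspose_mul, hQi, Matrix.sub_mul, Matrix.sub_mul,
      Matrix.mul_sub, Matrix.mul_sub, Matrix.mul_assoc Xᴴ, Matrix.nonsing_inv_mul _ hu,
      Matrix.mul_one, Matrix.mul_assoc Gᴴ Q (Q⁻¹ * X), Matrix.mul_nonsing_inv_cancel_left _ _ hu,
      Matrix.mul_assoc Xᴴ]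
    abel
  rw [hinv, h2, hQdef]
  simp only [Matrix.conjTranspose_sub, Matrix.conjTranspose_mul, Matrix.conjTranspose_conjTranspose,
    Matrix.conjTranspose_one, Matrix.add_mul, Matrix.mul_add, Matrix.sub_mul, Matrix.mul_sub,
    Matrix.mul_assoc, Matrix.one_mul, Matrix.mul_one]
  abel

theorem mse_lmmse {N M d : ℕ} (Hk : Matrix (Fin N) (Fin M) ℂ) (W : Matrix (Fin M) (Fin d) ℂ) :
    mse Hk (lmmse Hk W) W = (slack Hk W)⁻¹ := by
  rw [mse_lmmse_add]; simp

open scoped MatrixOrder Matrix.Norms.L2Operator in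
theorem posSemidef_eq_mul_conjTranspose {n : ℕ} {S : Matrix (Fin n) (Fin n) ℂ}
    (hS : S.PosSemidef) : ∃ B : Matrix (Fin n) (Fin n) ℂ, S = B * Bᴴ := by
  obtain ⟨C, rfl⟩ := CStarAlgebra.nonneg_iff_eq_star_mul_self.mp hS.nonneg
  exact ⟨Cᴴ, by simp [Matrix.star_eq_conjTranspose]⟩

theorem trace_mul_re_nonneg {n : ℕ} {S Y : Matrix (Fin n) (Fin n) ℂ}
    (hS : S.PosSemidef) (hY : Y.PosSemidef) : 0 ≤ (S * Y).trace.re := by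
  obtain ⟨B, rfl⟩ := posSemidef_eq_mul_conjTranspose hS
  rw [Matrix.mul_assoc, Matrix.trace_mul_comm]
  exact (Complex.le_def.mp (hY.conjTranspose_mul_mul_same B).trace_nonneg).1

/-- This is `log x ≤ x - 1` summed over the eigenvalues. -/
theorem logDet_le_trace_sub {n : ℕ} {X : Matrix (Fin n) (Fin n) ℂ} (hX : X.PosDef) :
    logDet X ≤ X.trace.re - n := by
  have hdet : X.det.re = ∏ i, hX.isHermitian.eigenvalues i := by
    rw [hX.isHermitian.det_eq_prod_eigenvalues]
    norm_cast
  have htr : X.trace.re = ∑ i, hX.isHermitian.eigenvalues i := by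
    rw [hX.isHermitian.trace_eq_sum_eigenvalues]
    norm_cast
  rw [logDet, hdet, htr, Real.log_prod fun i _ => (hX.eigenvalues_pos i).ne']
  calc _ ≤ ∑ i, (hX.isHermitian.eigenvalues i - 1) :=
        Finset.sum_le_sum fun i _ => Real.log_le_sub_one_of_pos (hX.eigenvalues_pos i)
    _ = _ := by simp

/-- `S * T⁻¹` need not be Hermitian, so the eigenvalue bound is applied to `Bᴴ * T⁻¹ * B` with `S =
B * Bᴴ`, which has the same trace and determinant. -/
theorem logDet_sub_le_trace_mul_inv {n : ℕ} {S T : Matrix (Fin n) (Fin n) ℂ}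
    (hS : S.PosDef) (hT : T.PosDef) : logDet S - logDet T ≤ (S * T⁻¹).trace.re - n := by
  obtain ⟨B, hB⟩ := posSemidef_eq_mul_conjTranspose hS.posSemidef
  have hBu : IsUnit B := by
    rw [Matrix.isUnit_iff_isUnit_det, isUnit_iff_ne_zero]
    intro h
    exact hS.det_pos.ne' (by rw [hB, Matrix.det_mul, h, zero_mul])
  have hX : (Bᴴ * T⁻¹ * B).PosDef := by
    refine hT.inv.conjTranspose_mul_mul_same ?_
    exact Matrix.mulVec_injective_of_isUnit hBu
  have htr : (S * T⁻¹).trace = (Bᴴ * T⁻¹ * B).trace := by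
    rw [hB, Matrix.mul_assoc, Matrix.trace_mul_comm]
  have hSd := Complex.pos_iff.mp hS.det_pos
  have hTd := Complex.pos_iff.mp hT.det_pos
  have hdet : (Bᴴ * T⁻¹ * B).det.re = S.det.re / T.det.re := by
    have h1 : (Bᴴ * T⁻¹ * B).det = S.det * T.det⁻¹ := by
      rw [hB, Matrix.det_mul, Matrix.det_mul, Matrix.det_mul, Matrix.det_nonsing_inv,
        Ring.inverse_eq_inv']
      ring
    have h2 : S.det = (S.det.re : ℂ) := Complex.ext rfl hSd.2.symm
    have h3 : T.det = (T.det.re : ℂ) := Complex.ext rfl hTd.2.symm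
    rw [h1, h2, h3, ← Complex.ofReal_inv, ← Complex.ofReal_mul, Complex.ofReal_re,
      Complex.ofReal_re, Complex.ofReal_re, div_eq_mul_inv]
  have h := logDet_le_trace_sub hX
  rw [htr]
  refine le_trans (le_of_eq ?_) h
  unfold logDet
  rw [hdet, Real.log_div hSd.1.ne' hTd.1.ne']

theorem userObj_le_rate {N M d : ℕ} (Hk : Matrix (Fin N) (Fin M) ℂ) (W : Matrix (Fin M) (Fin d) ℂ)
    (G : Matrix (Fin N) (Fin d) ℂ) {S : Matrix (Fin d) (Fin d) ℂ} (hS : S.PosDef) :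
    userObj Hk W G S ≤ rate Hk W := by
  have hQ : (Hk * W * Wᴴ * Hkᴴ + 1).PosSemidef := by
    have : Hk * W * Wᴴ * Hkᴴ + 1 = (Hk * W) * (Hk * W)ᴴ + 1 := by
      simp [Matrix.conjTranspose_mul, Matrix.mul_assoc]
    rw [this]
    exact (Matrix.posSemidef_self_mul_conjTranspose _).add Matrix.PosSemidef.one
  have h1 := trace_mul_re_nonneg hS.posSemidef
    (hQ.conjTranspose_mul_mul_same (G - lmmse Hk W))
  have h2 := logDet_sub_le_trace_mul_inv hS (posDef_slack Hk W)
  rw [userObj, mse_lmmse_add, Matrix.mul_add, Matrix.trace_add, Complex.add_re,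
    rate_eq_logDet_slack]
  linarith

theorem userObj_lmmse_slack {N M d : ℕ} (Hk : Matrix (Fin N) (Fin M) ℂ)
    (W : Matrix (Fin M) (Fin d) ℂ) :
    userObj Hk W (lmmse Hk W) (slack Hk W) = rate Hk W := by
  rw [userObj, mse_lmmse, Matrix.mul_nonsing_inv _ (posDef_slack Hk W).det_pos.ne'.isUnit,
    rate_eq_logDet_slack]
  simp

/-- Splits the weighted error into the two Frobenius norms of the cone program, for any factor `B`.
-/
theorem trace_mul_mse {N M d : ℕ} (Hk : Matrix (Fin N) (Fin M) ℂ) (W : Matrix (Fin M) (Fin d) ℂ)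
    (G : Matrix (Fin N) (Fin d) ℂ) (B : Matrix (Fin d) (Fin d) ℂ) :
    (B * Bᴴ * mse Hk G W).trace.re = frobSq (Bᴴ * (Gᴴ * Hk * W - 1)) + frobSq (G * B) := by
  have key : ∀ {m : ℕ} (A : Matrix (Fin d) (Fin m) ℂ),
      (B * Bᴴ * (A * Aᴴ)).trace = ((Bᴴ * A) * (Bᴴ * A)ᴴ).trace := by
    intro m A
    rw [Matrix.conjTranspose_mul, Matrix.conjTranspose_conjTranspose, Matrix.mul_assoc,
      Matrix.trace_mul_comm]
    simp only [Matrix.mul_assoc]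
  rw [frobSq_eq_trace, frobSq_eq_trace (G * B), mse, Matrix.mul_add, Matrix.trace_add,
    Complex.add_re, key, Matrix.trace_mul_comm (G * B)]
  congr 2
  have := key Gᴴ
  rw [Matrix.conjTranspose_conjTranspose] at this
  rw [this]
  simp [Matrix.conjTranspose_mul, Matrix.mul_assoc]

end MatrixIdentities

/-! ### The cone program as maximization of the surrogate. -/

section AscentSteps

variable {K M d : ℕ} {N : Fin K → ℕ} (H : ∀ k, Matrix (Fin (N k)) (Fin M) ℂ)

theorem socpFeasible_iff (P : ℝ)
    (G : ∀ k, Matrix (Fin (N k)) (Fin d) ℂ) {S B : Fin K → Matrix (Fin d) (Fin d) ℂ}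
    (hSB : ∀ k, S k = B k * (B k)ᴴ) (W : Matrix (Fin M) (Fin d) ℂ) (β : ℝ) :
    SOCPFeasible H P G S B W β ↔
      W ∈ codebook M d P ∧ ∀ k, β ≤ userObj (H k) W (G k) (S k) := by
  refine and_congr_right fun _ => forall_congr' fun k => ?_
  have h := trace_mul_mse (H k) W (G k) (B k)
  rw [← hSB] at h
  rw [userObj, h]
  constructor <;> intro h' <;> linarith

theorem SOCPSolution.mem_codebook {P : ℝ}
    {G : ∀ k, Matrix (Fin (N k)) (Fin d) ℂ} {S B : Fin K → Matrix (Fin d) (Fin d) ℂ}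
    {W : Matrix (Fin M) (Fin d) ℂ} (h : SOCPSolution H P G S B W) : W ∈ codebook M d P :=
  h.choose_spec.1.1

theorem SOCPSolution.obj_le [Nonempty (Fin K)] {P : ℝ}
    {G : ∀ k, Matrix (Fin (N k)) (Fin d) ℂ} {S B : Fin K → Matrix (Fin d) (Fin d) ℂ}
    (hSB : ∀ k, S k = B k * (B k)ᴴ) {W : Matrix (Fin M) (Fin d) ℂ}
    (h : SOCPSolution H P G S B W) {V : Matrix (Fin M) (Fin d) ℂ} (hV : V ∈ codebook M d P) :
    obj H V G S ≤ obj H W G S := by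
  obtain ⟨β, hf, hmax⟩ := h
  have h1 : obj H V G S ≤ β := hmax V _ ((socpFeasible_iff H P G hSB V _).mpr
    ⟨hV, fun k => ciInf_le (Set.finite_range _).bddBelow k⟩)
  exact h1.trans (le_ciInf ((socpFeasible_iff H P G hSB W β).mp hf).2)

theorem obj_le_minRate [Nonempty (Fin K)] (W : Matrix (Fin M) (Fin d) ℂ)
    (G : ∀ k, Matrix (Fin (N k)) (Fin d) ℂ) (V : Matrix (Fin M) (Fin d) ℂ) :
    obj H W G (fun k => slack (H k) V) ≤ minRate H W :=
  ciInf_mono (Set.finite_range _).bddBelow fun _ => userObj_le_rate _ _ _ (posDef_slack _ _)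

theorem obj_lmmse_slack (W : Matrix (Fin M) (Fin d) ℂ) :
    obj H W (fun k => lmmse (H k) W) (fun k => slack (H k) W) = minRate H W :=
  iInf_congr fun _ => userObj_lmmse_slack _ W

end AscentSteps

/-- **Gordan's theorem** of the alternative, for the members of a finite family of linear
functionals that satisfy `p`. -/
theorem exists_nonneg_combination_eq_zero {ι E : Type*} [Fintype ι] [AddCommGroup E] [Module ℝ E]
    (p : ι → Prop) (A : ι → E →ₗ[ℝ] ℝ) (h : ∀ x, ∃ i, p i ∧ A i x ≤ 0) :
    ∃ c : ι → ℝ, (∀ i, 0 ≤ c i) ∧ (∀ i, ¬ p i → c i = 0) ∧ 0 < ∑ i, c i ∧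
      ∑ i, c i • A i = 0 := by
  classical
  let s : Set (ι → ℝ) := {y | ∀ i, p i → 0 < y i}
  have hsc : Convex ℝ s := by
    have : s = ⋂ i, ⋂ _ : p i, {y | 0 < y i} := by ext; simp [s]
    rw [this]
    exact convex_iInter fun i => convex_iInter fun _ =>
      convex_halfSpace_gt (LinearMap.proj (R := ℝ) (φ := fun _ : ι => ℝ) i).isLinear 0
  have hso : IsOpen s := by
    have : s = ⋂ i, ⋂ _ : p i, {y | 0 < y i} := by ext; simp [s]
    rw [this]
    exact isOpen_iInter_of_finite fun i => isOpen_iInter_of_finite fun _ =>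
      isOpen_lt continuous_const (continuous_apply i)
  let T : E →ₗ[ℝ] (ι → ℝ) := LinearMap.pi A
  have hdisj : Disjoint s (LinearMap.range T : Set (ι → ℝ)) := by
    rw [Set.disjoint_left]
    rintro _ hy ⟨x, rfl⟩
    obtain ⟨i, hi, hle⟩ := h x
    exact absurd (hy i hi) (not_lt.mpr hle)
  obtain ⟨f, u, hfs, hft⟩ :=
    geometric_hahn_banach_open hsc hso (LinearMap.range T).convex hdisj
  have hu : u ≤ 0 := by simpa using hft 0 (Submodule.zero_mem _)
  have hzero : ∀ x, f (T x) = 0 := by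
    intro x
    by_contra hne
    -- A functional bounded below on a subspace vanishes there: this multiple of `x` would give the
    -- value `u - 1 < u`.
    have h1 := hft (T (((u - 1) / f (T x)) • x)) ⟨_, rfl⟩
    rw [map_smul, map_smul, smul_eq_mul, div_mul_cancel₀ _ hne] at h1
    linarith
  have hneg : ∀ y : ι → ℝ, (∀ i, p i → 0 ≤ y i) → f y ≤ 0 := by
    intro y hy
    -- Adding `t • 1` moves `y` into the open cone `s`, where `f < u ≤ 0`; then `t` tends to `0`.
    have hev : ∀ t : ℝ, 0 < t → f y + t * f 1 ≤ 0 := by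
      intro t ht
      have := hfs (y + t • 1) (fun i hi => by
        simpa using add_pos_of_nonneg_of_pos (hy i hi) ht)
      rw [map_add, map_smul, smul_eq_mul] at this
      linarith
    have hlim : Tendsto (fun t : ℝ => f y + t * f 1) (𝓝[>] 0) (𝓝 (f y + 0 * f 1)) :=
      ((continuous_const.add (continuous_id.mul continuous_const)).tendsto 0).mono_left
        nhdsWithin_le_nhds
    have := le_of_tendsto hlim (eventually_nhdsWithin_of_forall fun t ht => hev t ht)
    simpa using this
  have hsum : ∀ y : ι → ℝ, f y = ∑ i, y i * f (Pi.single i 1) := by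
    intro y
    conv_lhs => rw [pi_eq_sum_univ' y]
    rw [map_sum]
    refine Finset.sum_congr rfl fun i _ => ?_
    rw [map_smul, smul_eq_mul]
  refine ⟨fun i => -f (Pi.single i 1), fun i => ?_, fun i hi => ?_, ?_, ?_⟩
  · exact neg_nonneg.mpr (hneg _ fun j _ => by
      by_cases hj : j = i
      · subst hj; simp
      · simp [hj])
  · have h1 := hneg (Pi.single i 1) fun j hj => by
      have : j ≠ i := by rintro rfl; exact hi hj
      simp [this]
    have h2 := hneg (-Pi.single i 1) fun j hj => by
      have : j ≠ i := by rintro rfl; exact hi hj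
      simp [this]
    rw [map_neg] at h2
    linarith
  · have h1 := hfs 1 fun i _ => by simp
    rw [hsum] at h1
    simp only [Pi.one_apply, one_mul] at h1
    rw [Finset.sum_neg_distrib]
    linarith
  · ext x
    have h1 := hzero x
    rw [hsum] at h1
    simp only [LinearMap.sum_apply, LinearMap.smul_apply, smul_eq_mul, LinearMap.zero_apply,
      neg_mul, Finset.sum_neg_distrib, neg_eq_zero]
    rw [← h1]
    exact Finset.sum_congr rfl fun i _ => by rw [mul_comm]; rfl

/-! ### First-order behaviour along a ray. -/

theorem hasDerivAt_comp_add_smul {E : Type*} [NormedAddCommGroup E] [NormedSpace ℝ E] {f : E → ℝ}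
    {x : E} (hf : DifferentiableAt ℝ f x) (v : E) :
    HasDerivAt (fun t : ℝ => f (x + t • v)) (fderiv ℝ f x v) 0 := by
  have h1 : HasDerivAt (fun t : ℝ => x + t • v) v 0 := by
    simpa only [one_smul, id] using ((hasDerivAt_id (0 : ℝ)).smul_const v).const_add x
  have h2 : HasFDerivAt f (fderiv ℝ f x) (x + (0 : ℝ) • v) := by
    simpa using hf.hasFDerivAt
  exact h2.comp_hasDerivAt (0 : ℝ) h1

theorem eventually_lt_of_fderiv_pos {E : Type*} [NormedAddCommGroup E] [NormedSpace ℝ E]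
    {f : E → ℝ} {x : E} (hf : DifferentiableAt ℝ f x) {v : E} (hv : 0 < fderiv ℝ f x v) :
    ∀ᶠ t : ℝ in 𝓝[>] 0, f x < f (x + t • v) := by
  have h := (hasDerivAt_iff_tendsto_slope.mp (hasDerivAt_comp_add_smul hf v)).mono_left
    (nhdsWithin_mono (0 : ℝ) (fun t (ht : 0 < t) => ht.ne'))
  filter_upwards [h.eventually (lt_mem_nhds hv), self_mem_nhdsWithin] with t ht (ht0 : 0 < t)
  rw [slope_def_field, zero_smul, add_zero, sub_zero] at ht
  exact sub_pos.mp ((div_pos_iff_of_pos_right ht0).mp ht)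

theorem eventually_lt_of_lt {E : Type*} [NormedAddCommGroup E] [NormedSpace ℝ E]
    {f : E → ℝ} {x : E} (hf : DifferentiableAt ℝ f x) (v : E) {c : ℝ} (hc : c < f x) :
    ∀ᶠ t : ℝ in 𝓝[>] 0, c < f (x + t • v) := by
  have h := (hasDerivAt_comp_add_smul hf v).continuousAt.tendsto
  rw [zero_smul, add_zero] at h
  exact (h.eventually (lt_mem_nhds hc)).filter_mono nhdsWithin_le_nhds

/-! ### Smoothness, continuity and compactness, with the entrywise sup norm on matrices. -/

section Regularity

open scoped ComplexOrder

attribute [local instance] Matrix.normedAddCommGroup Matrix.normedSpace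

variable {N M d : ℕ}

theorem differentiable_matrix_iff {E : Type*} [NormedAddCommGroup E] [NormedSpace ℝ E] {m n : ℕ}
    {f : E → Matrix (Fin m) (Fin n) ℂ} :
    Differentiable ℝ f ↔ ∀ i j, Differentiable ℝ fun x => f x i j := by
  refine ⟨fun h i j => ?_, fun h => ?_⟩
  · exact differentiable_pi.mp (differentiable_pi.mp h i) j
  · exact differentiable_pi.mpr fun i => differentiable_pi.mpr fun j => h i j

theorem Differentiable.matrix_mul {E : Type*} [NormedAddCommGroup E] [NormedSpace ℝ E] {l m n : ℕ}
    {f : E → Matrix (Fin l) (Fin m) ℂ} {g : E → Matrix (Fin m) (Fin n) ℂ}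
    (hf : Differentiable ℝ f) (hg : Differentiable ℝ g) : Differentiable ℝ fun x => f x * g x := by
  rw [differentiable_matrix_iff] at *
  intro i j
  simp only [Matrix.mul_apply]
  fun_prop

theorem Differentiable.matrix_conjTranspose {E : Type*} [NormedAddCommGroup E] [NormedSpace ℝ E]
    {m n : ℕ} {f : E → Matrix (Fin m) (Fin n) ℂ}
    (hf : Differentiable ℝ f) : Differentiable ℝ fun x => (f x)ᴴ := by
  rw [differentiable_matrix_iff] at *
  intro i j
  exact (Complex.conjCLE.differentiable).comp (hf j i)

theorem Differentiable.matrix_det {E : Type*} [NormedAddCommGroup E] [NormedSpace ℝ E]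
    {n : ℕ} {f : E → Matrix (Fin n) (Fin n) ℂ}
    (hf : Differentiable ℝ f) : Differentiable ℝ fun x => (f x).det := by
  rw [differentiable_matrix_iff] at hf
  simp only [Matrix.det_apply']
  fun_prop

theorem Differentiable.matrix_trace {E : Type*} [NormedAddCommGroup E] [NormedSpace ℝ E]
    {n : ℕ} {f : E → Matrix (Fin n) (Fin n) ℂ}
    (hf : Differentiable ℝ f) : Differentiable ℝ fun x => (f x).trace := by
  rw [differentiable_matrix_iff] at hf
  simp only [Matrix.trace, Matrix.diag_apply]
  fun_prop

theorem Differentiable.complex_re {E : Type*} [NormedAddCommGroup E] [NormedSpace ℝ E]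
    {f : E → ℂ} (hf : Differentiable ℝ f) : Differentiable ℝ fun x => (f x).re :=
  Complex.reCLM.differentiable.comp hf

theorem differentiable_userObj (Hk : Matrix (Fin N) (Fin M) ℂ) (G : Matrix (Fin N) (Fin d) ℂ)
    (S : Matrix (Fin d) (Fin d) ℂ) :
    Differentiable ℝ fun V : Matrix (Fin M) (Fin d) ℂ => userObj Hk V G S := by
  have h1 : Differentiable ℝ fun V : Matrix (Fin M) (Fin d) ℂ => Gᴴ * Hk * V - 1 :=
    (Differentiable.matrix_mul (differentiable_const _) differentiable_id).sub_const _
  have h2 : Differentiable ℝ fun V : Matrix (Fin M) (Fin d) ℂ => (S * mse Hk G V).trace.re :=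
    Differentiable.complex_re <| Differentiable.matrix_trace <|
      Differentiable.matrix_mul (differentiable_const _)
      ((Differentiable.matrix_mul h1 (Differentiable.matrix_conjTranspose h1)).add_const _)
  exact (h2.neg.add_const _).add_const _

theorem differentiable_slack (Hk : Matrix (Fin N) (Fin M) ℂ) :
    Differentiable ℝ fun V : Matrix (Fin M) (Fin d) ℂ => slack Hk V :=
  (Differentiable.matrix_mul (Differentiable.matrix_mul (Differentiable.matrix_mul
    (Differentiable.matrix_conjTranspose differentiable_id) (differentiable_const _))
    (differentiable_const _)) differentiable_id).add_const _

theorem differentiable_frobSq :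
    Differentiable ℝ fun V : Matrix (Fin M) (Fin d) ℂ => frobSq V := by
  have h := differentiable_matrix_iff.mp (differentiable_id (𝕜 := ℝ) (E := Matrix (Fin M) (Fin d) ℂ))
  simp only [id] at h
  unfold frobSq
  refine Differentiable.fun_sum fun i _ => Differentiable.fun_sum fun j _ => ?_
  exact (h i j).norm_sq ℝ

theorem differentiable_rate (Hk : Matrix (Fin N) (Fin M) ℂ) :
    Differentiable ℝ fun V : Matrix (Fin M) (Fin d) ℂ => rate Hk V := by
  simp only [rate_eq_logDet_slack]
  refine Differentiable.log (Differentiable.complex_re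
    (Differentiable.matrix_det (differentiable_slack Hk))) fun V => ?_
  exact (Complex.pos_iff.mp (posDef_slack Hk V).det_pos).1.ne'

/-- Rate minus surrogate is nonnegative and vanishes at `W`, so `W` is a minimum and the derivatives
agree without being computed. -/
theorem fderiv_userObj_eq_fderiv_rate (Hk : Matrix (Fin N) (Fin M) ℂ)
    (W : Matrix (Fin M) (Fin d) ℂ) :
    fderiv ℝ (fun V => userObj Hk V (lmmse Hk W) (slack Hk W)) W =
      fderiv ℝ (fun V => rate Hk V) W := by
  have hr := (differentiable_rate Hk W).hasFDerivAt
  have hu := (differentiable_userObj Hk (lmmse Hk W) (slack Hk W) W).hasFDerivAt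
  have hmin : IsLocalMin
      (fun V => rate Hk V - userObj Hk V (lmmse Hk W) (slack Hk W)) W := by
    refine Eventually.of_forall fun V => ?_
    simp only [userObj_lmmse_slack, sub_self]
    exact sub_nonneg.mpr (userObj_le_rate _ _ _ (posDef_slack Hk W))
  exact (sub_eq_zero.mp (hmin.hasFDerivAt_eq_zero (hr.sub hu))).symm

theorem rate_zero (Hk : Matrix (Fin N) (Fin M) ℂ) :
    rate Hk (0 : Matrix (Fin M) (Fin d) ℂ) = 0 := by
  simp [rate, logDet]

theorem rate_nonneg (Hk : Matrix (Fin N) (Fin M) ℂ) (W : Matrix (Fin M) (Fin d) ℂ) :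
    0 ≤ rate Hk W := by
  -- With `G = 0` and `S = 1` the surrogate is `-d + 0 + d = 0`.
  have h := userObj_le_rate Hk W 0 Matrix.PosDef.one
  simpa [userObj, mse, logDet] using h

theorem fderiv_rate_zero (Hk : Matrix (Fin N) (Fin M) ℂ) :
    fderiv ℝ (fun V : Matrix (Fin M) (Fin d) ℂ => rate Hk V) 0 = 0 := by
  have hmin : IsLocalMin (fun V : Matrix (Fin M) (Fin d) ℂ => rate Hk V) 0 :=
    Eventually.of_forall fun V => by simpa only [rate_zero] using rate_nonneg Hk V
  exact hmin.fderiv_eq_zero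

theorem frobSq_smul (t : ℝ) (W : Matrix (Fin M) (Fin d) ℂ) :
    frobSq (t • W) = t ^ 2 * frobSq W := by
  simp only [frobSq, Finset.mul_sum, Matrix.smul_apply, norm_smul, mul_pow, Real.norm_eq_abs,
    sq_abs]

theorem frobSq_pos {W : Matrix (Fin M) (Fin d) ℂ} (hW : W ≠ 0) : 0 < frobSq W := by
  obtain ⟨i, j, hij⟩ : ∃ i j, W i j ≠ 0 := by
    by_contra! h
    exact hW (Matrix.ext h)
  refine Finset.sum_pos' (fun i _ => Finset.sum_nonneg fun j _ => by positivity)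
    ⟨i, Finset.mem_univ _, Finset.sum_pos' (fun j _ => by positivity)
      ⟨j, Finset.mem_univ _, by positivity⟩⟩

/-- Euler's identity for a function homogeneous of degree two. -/
theorem fderiv_frobSq_self (W : Matrix (Fin M) (Fin d) ℂ) :
    fderiv ℝ (fun V : Matrix (Fin M) (Fin d) ℂ => frobSq V) W W = 2 * frobSq W := by
  have h2 := hasDerivAt_comp_add_smul (differentiable_frobSq W) W
  have h3 : HasDerivAt (fun t : ℝ => (1 + t) ^ 2 * frobSq W) (2 * frobSq W) 0 := by
    have := (((hasDerivAt_id (0 : ℝ)).const_add 1).pow 2).mul_const (frobSq W)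
    simpa using this
  refine h2.unique (h3.congr_of_eventuallyEq (Eventually.of_forall fun t => ?_))
  beta_reduce
  rw [← frobSq_smul, add_smul, one_smul]

theorem continuous_minRate {K : ℕ} [Nonempty (Fin K)] {N : Fin K → ℕ}
    (H : ∀ k, Matrix (Fin (N k)) (Fin M) ℂ) :
    Continuous fun V : Matrix (Fin M) (Fin d) ℂ => minRate H V := by
  simp only [minRate, ← Finset.inf'_univ_eq_ciInf]
  exact Continuous.finset_inf'_apply _ fun k _ => (differentiable_rate (H k)).continuous

theorem continuous_slack (Hk : Matrix (Fin N) (Fin M) ℂ) :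
    Continuous fun V : Matrix (Fin M) (Fin d) ℂ => slack Hk V :=
  (differentiable_slack Hk).continuous

theorem continuous_lmmse (Hk : Matrix (Fin N) (Fin M) ℂ) :
    Continuous fun V : Matrix (Fin M) (Fin d) ℂ => lmmse Hk V := by
  have hQ : Continuous fun V : Matrix (Fin M) (Fin d) ℂ => Hk * V * Vᴴ * Hkᴴ + 1 := by fun_prop
  have hdet : ∀ V : Matrix (Fin M) (Fin d) ℂ, (Hk * V * Vᴴ * Hkᴴ + 1).det ≠ 0 := by
    intro V
    rw [add_comm, Matrix.mul_assoc (Hk * V), Matrix.det_one_add_mul_comm, add_comm,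
      ← Matrix.mul_assoc]
    exact (posDef_slack Hk V).det_pos.ne'
  unfold lmmse
  -- The inverse is the adjugate divided by a determinant that never vanishes.
  simp only [Matrix.inv_def, Ring.inverse_eq_inv']
  exact ((hQ.matrix_det.inv₀ hdet).smul hQ.matrix_adjugate).matrix_mul
    (continuous_const.matrix_mul continuous_id)

theorem continuous_obj_lmmse_slack {K : ℕ} [Nonempty (Fin K)] {N : Fin K → ℕ}
    (H : ∀ k, Matrix (Fin (N k)) (Fin M) ℂ) (V : Matrix (Fin M) (Fin d) ℂ) :
    Continuous fun X : Matrix (Fin M) (Fin d) ℂ =>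
      obj H V (fun k => lmmse (H k) X) (fun k => slack (H k) X) := by
  simp only [obj, ← Finset.inf'_univ_eq_ciInf]
  refine Continuous.finset_inf'_apply _ fun k _ => ?_
  have hG := continuous_lmmse (d := d) (H k)
  have hS := continuous_slack (d := d) (H k)
  have hlog : Continuous fun X : Matrix (Fin M) (Fin d) ℂ => logDet (slack (H k) X) := by
    simp only [← rate_eq_logDet_slack]
    exact (differentiable_rate (H k)).continuous
  have htr : Continuous fun X : Matrix (Fin M) (Fin d) ℂ =>
      (slack (H k) X * mse (H k) (lmmse (H k) X) V).trace.re := by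
    unfold mse
    fun_prop
  exact (htr.neg.add hlog).add continuous_const

theorem isCompact_codebook (P : ℝ) : IsCompact (codebook M d P) := by
  have hK : IsCompact {W : Matrix (Fin M) (Fin d) ℂ |
      ∀ i, W i ∈ {w : Fin d → ℂ | ∀ j, w j ∈ Metric.closedBall (0 : ℂ) √P}} :=
    isCompact_pi_infinite fun _ => isCompact_pi_infinite fun _ => isCompact_closedBall _ _
  refine hK.of_isClosed_subset
    (isClosed_le differentiable_frobSq.continuous continuous_const) fun W hW i j => ?_
  rw [mem_closedBall_zero_iff]
  refine Real.le_sqrt_of_sq_le (le_trans ?_ hW)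
  calc ‖W i j‖ ^ 2 ≤ ∑ j, ‖W i j‖ ^ 2 :=
        Finset.single_le_sum (f := fun j => ‖W i j‖ ^ 2) (fun _ _ => by positivity)
          (Finset.mem_univ j)
    _ ≤ frobSq W := Finset.single_le_sum (f := fun i => ∑ j, ‖W i j‖ ^ 2)
        (fun _ _ => Finset.sum_nonneg fun _ _ => by positivity) (Finset.mem_univ i)

end Regularity

/-! ### From surrogate optimality to the KKT conditions. -/

section Stationarity

attribute [local instance] Matrix.normedAddCommGroup Matrix.normedSpace

variable {K M d : ℕ} {N : Fin K → ℕ} {H : ∀ k, Matrix (Fin (N k)) (Fin M) ℂ} {P : ℝ}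
  {W : Matrix (Fin M) (Fin d) ℂ}

/-- A maximizer of the surrogate objective built at itself admits no direction that increases all
active rates to first order and decreases the power, if the power constraint is active. -/
theorem not_exists_ascent_direction [Nonempty (Fin K)] (hW : W ∈ codebook M d P)
    (hopt : ∀ V ∈ codebook M d P,
      obj H V (fun k => lmmse (H k) W) (fun k => slack (H k) W) ≤ minRate H W)
    (v : Matrix (Fin M) (Fin d) ℂ)
    (hrate : ∀ k, rate (H k) W = minRate H W → 0 < fderiv ℝ (fun V => rate (H k) V) W v)
    (hpow : frobSq W = P →
      fderiv ℝ (fun V : Matrix (Fin M) (Fin d) ℂ => frobSq V) W v < 0) : False := by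
  have hu : ∀ k, ∀ᶠ t : ℝ in 𝓝[>] 0,
      minRate H W < userObj (H k) (W + t • v) (lmmse (H k) W) (slack (H k) W) := by
    intro k
    have hd := differentiable_userObj (H k) (lmmse (H k) W) (slack (H k) W) W
    have hle : minRate H W ≤ rate (H k) W := ciInf_le (Set.finite_range _).bddBelow k
    -- Active users gain to first order; for inactive ones the strict gap survives a small step by
    -- continuity.
    rcases hle.eq_or_lt with h | h
    · have hv := hrate k h.symm
      rw [← fderiv_userObj_eq_fderiv_rate] at hv
      have := eventually_lt_of_fderiv_pos hd hv
      rwa [userObj_lmmse_slack, ← h] at this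
    · rw [← userObj_lmmse_slack] at h
      exact eventually_lt_of_lt hd v h
  have hp : ∀ᶠ t : ℝ in 𝓝[>] 0, W + t • v ∈ codebook M d P := by
    have hd : DifferentiableAt ℝ (fun V : Matrix (Fin M) (Fin d) ℂ => -frobSq V) W :=
      (differentiable_frobSq W).neg
    have hev : ∀ᶠ t : ℝ in 𝓝[>] 0, -P < -frobSq (W + t • v) := by
      rcases (show frobSq W ≤ P from hW).eq_or_lt with h | h
      · have := eventually_lt_of_fderiv_pos hd (v := v) (by
          rw [fderiv_fun_neg]; exact neg_pos.mpr (hpow h))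
        rwa [h] at this
      · exact eventually_lt_of_lt hd v (neg_lt_neg h)
    exact hev.mono fun t ht => (neg_lt_neg_iff.mp ht).le
  obtain ⟨t, ht, hmem⟩ := ((eventually_all.mpr hu).and hp).exists
  obtain ⟨k, hk⟩ := exists_eq_ciInf_of_finite
    (f := fun k => userObj (H k) (W + t • v) (lmmse (H k) W) (slack (H k) W))
  have h1 := hopt _ hmem
  rw [obj, ← hk] at h1
  exact absurd h1 (not_le.mpr (ht k))

theorem isStationary_of_forall_obj_le [Nonempty (Fin K)] (hW : W ∈ codebook M d P)
    (hopt : ∀ V ∈ codebook M d P,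
      obj H V (fun k => lmmse (H k) W) (fun k => slack (H k) W) ≤ minRate H W) :
    IsStationary H P W := by
  classical
  let A : Fin K → Matrix (Fin M) (Fin d) ℂ →L[ℝ] ℝ := fun k => fderiv ℝ (fun V => rate (H k) V) W
  let D : Matrix (Fin M) (Fin d) ℂ →L[ℝ] ℝ := fderiv ℝ (fun V => frobSq V) W
  suffices h : ∃ (lam : Fin K → ℝ) (ν : ℝ), (∀ k, 0 ≤ lam k) ∧ 0 ≤ ν ∧ ∑ k, lam k = 1 ∧
      ∑ k, lam k • A k = ν • D ∧ (∀ k, lam k * (rate (H k) W - minRate H W) = 0) ∧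
      ν * (frobSq W - P) = 0 by
    obtain ⟨lam, ν, h⟩ := h
    exact ⟨hW, A, D, lam, ν, fun k => (differentiable_rate (H k) W).hasFDerivAt,
      (differentiable_frobSq W).hasFDerivAt, h⟩
  -- At `W = 0` the power gradient vanishes too, so the general argument could leave no weight on
  -- the rates. All rate gradients are zero, so one minimizing user with `ν = 0` suffices.
  rcases eq_or_ne W 0 with h0 | h0
  · obtain ⟨k₀, hk₀⟩ := exists_eq_ciInf_of_finite (f := fun k => rate (H k) W)
    refine ⟨Pi.single k₀ 1, 0, fun k => ?_, le_rfl, by simp, ?_, fun k => ?_, zero_mul _⟩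
    · by_cases h : k = k₀
      · subst h; simp
      · simp [h]
    · have hA : ∀ k, A k = 0 := fun k => by
        simp only [A, h0]; exact fderiv_rate_zero (H k)
      simp [hA]
    · by_cases h : k = k₀
      · subst h
        rw [minRate, ← hk₀, sub_self, mul_zero]
      · simp [h]
  -- `none` stands for the power constraint; `p` selects the active constraints.
  let p : Option (Fin K) → Prop
    | none => frobSq W = P
    | some k => rate (H k) W = minRate H W
  let F : Option (Fin K) → Matrix (Fin M) (Fin d) ℂ →ₗ[ℝ] ℝ
    | none => -(D : Matrix (Fin M) (Fin d) ℂ →ₗ[ℝ] ℝ)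
    | some k => A k
  obtain ⟨c, hc0, hcp, hcs, hcF⟩ := exists_nonneg_combination_eq_zero p F (by
    intro v
    by_contra! h
    refine not_exists_ascent_direction hW hopt v (fun k hk => h (some k) hk) fun hP => ?_
    have := h none hP
    simpa [F, D] using this)
  rw [Fintype.sum_option] at hcs hcF
  have hval : ∀ v, ∑ k, c (some k) * A k v = c none * D v := by
    intro v
    have := LinearMap.congr_fun hcF v
    simp only [F, LinearMap.add_apply, LinearMap.smul_apply, LinearMap.neg_apply,
      LinearMap.sum_apply, smul_eq_mul, LinearMap.zero_apply, ContinuousLinearMap.coe_coe] at this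
    linarith
  have hpos : 0 < ∑ k, c (some k) := by
    -- Otherwise only the power multiplier is positive, and evaluating the relation at `W` gives `0
    -- = c none * (2 * frobSq W)`, which is impossible.
    refine (Finset.sum_nonneg fun k _ => hc0 (some k)).lt_of_ne fun hs => ?_
    have hz : ∀ k, c (some k) = 0 := fun k =>
      (Finset.sum_eq_zero_iff_of_nonneg fun k _ => hc0 (some k)).mp hs.symm k (Finset.mem_univ k)
    have h1 := hval W
    simp only [hz, zero_mul, Finset.sum_const_zero] at h1
    have hDW : D W = 2 * frobSq W := fderiv_frobSq_self W
    rw [← hs, add_zero] at hcs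
    rw [hDW] at h1
    have := mul_pos hcs (mul_pos two_pos (frobSq_pos h0))
    linarith
  refine ⟨fun k => c (some k) / ∑ k, c (some k), c none / ∑ k, c (some k),
    fun k => div_nonneg (hc0 _) hpos.le, div_nonneg (hc0 _) hpos.le, ?_, ?_, fun k => ?_, ?_⟩
  · rw [← Finset.sum_div, div_self hpos.ne']
  · ext v
    simp only [sum_apply, smul_apply, smul_eq_mul,
      div_mul_eq_mul_div]
    rw [← Finset.sum_div, hval]
  · by_cases h : rate (H k) W = minRate H W
    · rw [h, sub_self, mul_zero]
    · beta_reduce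
      rw [hcp (some k) h, zero_div, zero_mul]
  · by_cases h : frobSq W = P
    · rw [h, sub_self, mul_zero]
    · rw [hcp none h, zero_div, zero_mul]

end Stationarity

/-! ### Monotonicity and accumulation points of a run. -/

section AscentRun

variable {K M d : ℕ} {N : Fin K → ℕ} {H : ∀ k, Matrix (Fin (N k)) (Fin M) ℂ} {P : ℝ}
  {W : ℕ → Matrix (Fin M) (Fin d) ℂ} {G : ℕ → ∀ k, Matrix (Fin (N k)) (Fin d) ℂ}
  {S : ℕ → Fin K → Matrix (Fin d) (Fin d) ℂ}

namespace IsAscentRun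

theorem filter_eq (h : IsAscentRun H P W G S) (i : ℕ) : G i = fun k => lmmse (H k) (W i) :=
  funext (h.filter_step i)

theorem slack_eq (h : IsAscentRun H P W G S) (i : ℕ) : S i = fun k => slack (H k) (W i) :=
  funext (h.slack_step i)

theorem mem_codebook (h : IsAscentRun H P W G S) : ∀ i, W i ∈ codebook M d P
  | 0 => h.init
  | i + 1 => (h.precoder_step i).choose_spec.2.mem_codebook

theorem obj_le_obj_succ [Nonempty (Fin K)] (h : IsAscentRun H P W G S) (i : ℕ)
    {V : Matrix (Fin M) (Fin d) ℂ} (hV : V ∈ codebook M d P) :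
    obj H V (G i) (S i) ≤ obj H (W (i + 1)) (G i) (S i) := by
  obtain ⟨B, hSB, hsol⟩ := h.precoder_step i
  exact hsol.obj_le H hSB hV

theorem obj_eq_minRate (h : IsAscentRun H P W G S) (i : ℕ) :
    obj H (W i) (G i) (S i) = minRate H (W i) := by
  rw [h.filter_eq, h.slack_eq, obj_lmmse_slack]

theorem obj_le_minRate [Nonempty (Fin K)] (h : IsAscentRun H P W G S) (i : ℕ)
    (V : Matrix (Fin M) (Fin d) ℂ) : obj H V (G i) (S i) ≤ minRate H V := by
  rw [h.slack_eq]
  exact Multicast.obj_le_minRate H V (G i) (W i)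

theorem monotone_minRate [Nonempty (Fin K)] (h : IsAscentRun H P W G S) :
    Monotone fun i => minRate H (W i) :=
  monotone_nat_of_le_succ fun i => by
    rw [← h.obj_eq_minRate i]
    exact (h.obj_le_obj_succ i (h.mem_codebook i)).trans (h.obj_le_minRate i _)

/-- The precoders `W (n + 1)` need not approach `Wbar` along with `W n`: monotonicity already bounds
all their rates by `minRate H Wbar`. Only closed conditions on `W n` are passed to the limit. -/
theorem isStationary_of_mapClusterPt [Nonempty (Fin K)] (h : IsAscentRun H P W G S)
    {Wbar : Matrix (Fin M) (Fin d) ℂ} (hc : MapClusterPt Wbar atTop W) :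
    IsStationary H P Wbar := by
  have hmem : ∀ s : Set (Matrix (Fin M) (Fin d) ℂ), IsClosed s →
      (∀ᶠ n in atTop, W n ∈ s) → Wbar ∈ s := fun s hs hev =>
    hs.closure_eq ▸ clusterPt_iff_forall_mem_closure.mp hc s hev
  have hle : ∀ i, minRate H (W i) ≤ minRate H Wbar := fun i =>
    hmem {X | minRate H (W i) ≤ minRate H X}
      (isClosed_le continuous_const (continuous_minRate H))
      ((eventually_ge_atTop i).mono fun n hn => h.monotone_minRate hn)
  refine isStationary_of_forall_obj_le (hmem _ (isCompact_codebook P).isClosed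
    (Eventually.of_forall h.mem_codebook)) fun V hV => ?_
  refine hmem {X | obj H V (fun k => lmmse (H k) X) (fun k => slack (H k) X) ≤ minRate H Wbar}
    (isClosed_le (continuous_obj_lmmse_slack H V) continuous_const)
    (Eventually.of_forall fun n => ?_)
  have h1 := h.obj_le_obj_succ n hV
  have h2 := h.obj_le_minRate n (W (n + 1))
  rw [Set.mem_ofPred_eq, ← h.filter_eq, ← h.slack_eq]
  exact (h1.trans h2).trans (hle (n + 1))

end IsAscentRun

end AscentRun

end Multicast

theorem proposition1 (K M d : ℕ) (hK : 0 < K) (N : Fin K → ℕ)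
    (H : ∀ k, Matrix (Fin (N k)) (Fin M) ℂ) (P : ℝ)
    (W : ℕ → Matrix (Fin M) (Fin d) ℂ) (G : ∀ _ : ℕ, ∀ k, Matrix (Fin (N k)) (Fin d) ℂ)
    (S : ℕ → Fin K → Matrix (Fin d) (Fin d) ℂ)
    (hrun : Multicast.IsAscentRun H P W G S) :
    -- the objective is non-decreasing, across the two steps of a pass and from pass to pass
    (∀ i, Multicast.obj H (W i) (G i) (S i) ≤ Multicast.obj H (W (i + 1)) (G i) (S i) ∧
      Multicast.obj H (W (i + 1)) (G i) (S i) ≤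
        Multicast.obj H (W (i + 1)) (G (i + 1)) (S (i + 1))) ∧
    Monotone (fun i => Multicast.minRate H (W i)) ∧
    -- if the precoders converge, the limit is a stationary point
    (∀ Wbar, Tendsto W atTop (𝓝 Wbar) → Multicast.IsStationary H P Wbar) ∧
    -- in any case there are accumulation points, and all of them are stationary points
    (∃ Wbar, MapClusterPt Wbar atTop W) ∧
    (∀ Wbar, MapClusterPt Wbar atTop W → Multicast.IsStationary H P Wbar) := by
  have : Nonempty (Fin K) := ⟨⟨0, hK⟩⟩
  refine ⟨fun i => ⟨hrun.obj_le_obj_succ i (hrun.mem_codebook i), ?_⟩, hrun.monotone_minRate,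
    fun Wbar h => hrun.isStationary_of_mapClusterPt h.mapClusterPt, ?_,
    fun Wbar h => hrun.isStationary_of_mapClusterPt h⟩
  · rw [hrun.obj_eq_minRate (i + 1)]
    exact hrun.obj_le_minRate i _
  · obtain ⟨Wbar, -, h⟩ := (Multicast.isCompact_codebook P).exists_mapClusterPt
      (f := atTop) (u := W) (by
        rw [le_principal_iff]
        exact Filter.mem_map.mpr (Filter.univ_mem' hrun.mem_codebook))
    exact ⟨Wbar, h⟩
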